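/- **Setting.** Let $E$ be a real vector space (of arbitrary dimension) and let $\{G_m\}_{m>0}$ be a family of pre-symplectic forms on $E$, i.e. of real-valued, bilinear, antisymmetric (possibly degenerate) forms, indexed by the masses $m\in\mathbb R^+=(0,\infty)$, such that $m\mapsto G_m(F,F')$ is continuous on $\mathbb R^+$ for all $F,F'\in E$. For $m>0$ let $\widetilde{\mathcal W}_m$ be the complex vector space with basis the Weyl elements $W_m(F)$, $F\in E$, made into a unital $*$-algebra by $$W_m(F)W_m(F')=e^{-iG_m(F,F')/2}\,W_m(F+F'),\qquad W_m(F)^*=W_m(-F),\qquad 1=W_m(0).$$ Let $\mathcal C(E,G_m)$ be the set of functions $C:E\to\mathbb C$ with $C(0)=1$ and $\sum_{i,j=1}^N\bar z_iz_j\,e^{iG_m(F_i,F_j)/2}\,C(F_j-F_i)\ge 0$ for all $N\in\mathbb N$, $z_i\in\mathbb C$, $F_i\in E$, and for such $C$ let $\omega_C$ be the linear functional on $\widetilde{\mathcal W}_m$ with $\omega_C(W_m(F))=C(F)$. The Weyl algebra $\mathcal W_m=\mathcal W_m(E,G_m)$ is the C*-algebra obtained as the completion of $\widetilde{\mathcal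 W}_m$ in the C*-norm $$\|A\|_m=\sup\Big\{\sqrt{\omega_C(A^*A)}\;:\;C\in\mathcal C(E,G_m)\Big\}.$$ A *continuous field of C\*-algebras* over $\{\mathcal W_m\}_{m>0}$ is a pair $(\{\mathcal W_m\}_m,\mathcal K)$ in which $\mathcal K$ is a sub-$*$-algebra of the $*$-algebra $\prod_{m>0}\mathcal W_m$ of all sections (with pointwise operations) such that 1. for every $K\in\mathcal K$ the map $\mathbb R^+\ni m\mapsto\|K(m)\|_m$ is continuous; 2. for every $m\in\mathbb R^+$ the set $\{K(m):K\in\mathcal K\}$ is dense in $\mathcal W_m$; 3. if $K\in\prod_{m>0}\mathcal W_m$ is such that for every $m_0\in\mathbb R^+$ and every $\epsilon>0$ there are $H\in\mathcal K$ and a neighbourhood $U_0$ of $m_0$ in $\mathbb R^+$ with $\|K(m)-H(m)\|_m<\epsilon$ for all $m\in U_0$, then $K\in\mathcal K$. **Theorem (Continuous Weyl C\*-field).** There exists a unique continuous field of C*-algebras $(\{\mathcal W_m\}_m,\mathcal K)$ such that for every $F\in E$ the section $[m\mapsto W_m(F)]$ belongs to $\mathcal K$. -/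

import Mathlib

open scoped ComplexOrder ComplexConjugate

/-- A pre-symplectic form on a real vector space: a real-valued bilinear form which is
alternating (equivalently, antisymmetric); it may be degenerate. -/
structure PresymplecticForm (E : Type*) [AddCommGroup E] [Module ℝ E] where
  /-- the underlying bilinear form -/
  form : E →ₗ[ℝ] E →ₗ[ℝ] ℝ
  alt : ∀ F, form F F = 0

namespace PresymplecticForm

variable {E : Type*} [AddCommGroup E] [Module ℝ E]

instance : CoeFun (PresymplecticForm E) (fun _ => E → E → ℝ) := ⟨fun σ F F' => σ.form F F'⟩

theorem antisymm (σ : PresymplecticForm E) (F F' : E) : σ F' F = - σ F F' := by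
  have h := σ.alt (F + F')
  simp only [map_add, LinearMap.add_apply, σ.alt] at h
  linarith

end PresymplecticForm

/-- The complex vector space with basis the Weyl elements `W(F)`, `F ∈ E`. With the twisted product
and the involution below it is the `*`-algebra spanned by the linearly independent Weyl elements. -/
def WeylSpan {E : Type*} [AddCommGroup E] [Module ℝ E] (_σ : PresymplecticForm E) : Type _ := E →₀ ℂ

namespace WeylSpan

section Algebra

variable {E : Type*} [AddCommGroup E] [Module ℝ E] {σ : PresymplecticForm E}

noncomputable instance : AddCommGroup (WeylSpan σ) := inferInstanceAs (AddCommGroup (E →₀ ℂ))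
noncomputable instance : Module ℂ (WeylSpan σ) := inferInstanceAs (Module ℂ (E →₀ ℂ))

/-- The Weyl elements, as the basis of their span. -/
noncomputable def basis (σ : PresymplecticForm E) : Module.Basis E ℂ (WeylSpan σ) :=
  Module.Basis.ofRepr (LinearEquiv.refl ℂ (E →₀ ℂ))

/-- The Weyl element `W(F)`. -/
noncomputable def W (σ : PresymplecticForm E) (F : E) : WeylSpan σ := basis σ F

/-- The bilinear twisted product, `W(F) W(F') = exp(-i σ(F,F') / 2) W(F + F')`. -/
noncomputable def mulₗ (σ : PresymplecticForm E) :
    WeylSpan σ →ₗ[ℂ] WeylSpan σ →ₗ[ℂ] WeylSpan σ :=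
  (basis σ).constr ℂ fun F => (basis σ).constr ℂ fun F' =>
    Complex.exp (-(Complex.I * (σ F F' : ℂ) / 2)) • W σ (F + F')

/-- The conjugate-linear involution, `W(F)^* = W(-F)`. -/
noncomputable def starₗ (σ : PresymplecticForm E) : WeylSpan σ →ₗ⋆[ℂ] WeylSpan σ where
  toFun A := ((basis σ).repr A).sum fun F a => conj a • W σ (-F)
  map_add' A B := by
    rw [map_add]
    refine Finsupp.sum_add_index' ?_ ?_
    · simp
    · intro F a b
      rw [map_add, add_smul]
  map_smul' c A := by
    rw [map_smul, Finsupp.smul_sum, Finsupp.sum_smul_index']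
    · simp [mul_smul]
    · simp

noncomputable instance : Mul (WeylSpan σ) := ⟨fun A B => mulₗ σ A B⟩
noncomputable instance : One (WeylSpan σ) := ⟨W σ 0⟩
noncomputable instance : Star (WeylSpan σ) := ⟨fun A => starₗ σ A⟩

theorem mul_def (A B : WeylSpan σ) : A * B = mulₗ σ A B := rfl
theorem one_def : (1 : WeylSpan σ) = W σ 0 := rfl
theorem star_def (A : WeylSpan σ) : star A = starₗ σ A := rfl

theorem W_mul_W (F F' : E) :
    W σ F * W σ F' = Complex.exp (-(Complex.I * (σ F F' : ℂ) / 2)) • W σ (F + F') := by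
  rw [mul_def, mulₗ, W, W, Module.Basis.constr_basis, Module.Basis.constr_basis]

theorem star_W (F : E) : star (W σ F) = W σ (-F) := by
  change ((basis σ).repr (basis σ F)).sum (fun F a => conj a • W σ (-F)) = _
  rw [Module.Basis.repr_self, Finsupp.sum_single_index] <;> simp

@[elab_as_elim]
theorem induction_linear {p : WeylSpan σ → Prop} (A : WeylSpan σ) (zero : p 0)
    (add : ∀ A B, p A → p B → p (A + B)) (smul : ∀ (c : ℂ) A, p A → p (c • A))
    (hW : ∀ F, p (W σ F)) : p A := by
  refine Submodule.span_induction (p := fun x _ => p x) ?_ zero (fun x y _ _ => add x y)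
    (fun c x _ => smul c x) ((basis σ).mem_span A)
  rintro _ ⟨F, rfl⟩
  exact hW F

theorem mul_smul' (c : ℂ) (A B : WeylSpan σ) : A * (c • B) = c • (A * B) := by
  simp only [mul_def, map_smul]

theorem smul_mul' (c : ℂ) (A B : WeylSpan σ) : (c • A) * B = c • (A * B) := by
  simp only [mul_def, map_smul, LinearMap.smul_apply]

theorem mul_add' (A B C : WeylSpan σ) : A * (B + C) = A * B + A * C := by
  simp only [mul_def, map_add]

theorem add_mul' (A B C : WeylSpan σ) : (A + B) * C = A * C + B * C := by
  simp only [mul_def, map_add, LinearMap.add_apply]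

theorem mul_zero' (A : WeylSpan σ) : A * 0 = 0 := by simp only [mul_def, map_zero]

theorem zero_mul' (A : WeylSpan σ) : 0 * A = 0 := by
  simp only [mul_def, map_zero, LinearMap.zero_apply]

theorem star_add' (A B : WeylSpan σ) : star (A + B) = star A + star B := by
  simp only [star_def, map_add]

theorem star_smul' (c : ℂ) (A : WeylSpan σ) : star (c • A) = conj c • star A := by
  simp only [star_def, map_smulₛₗ]

theorem star_zero' : star (0 : WeylSpan σ) = 0 := by simp only [star_def, map_zero]

theorem W_mul_W_assoc (F F' F'' : E) :
    W σ F * W σ F' * W σ F'' = W σ F * (W σ F' * W σ F'') := by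
  simp only [W_mul_W, smul_mul', mul_smul', smul_smul, ← Complex.exp_add, map_add,
    LinearMap.add_apply, add_assoc, Complex.ofReal_add]
  congr 2
  ring

theorem mul_assoc' (A B C : WeylSpan σ) : A * B * C = A * (B * C) := by
  induction A using induction_linear with
  | zero => simp only [zero_mul']
  | add A A' h h' => simp only [add_mul', h, h']
  | smul c A h => simp only [smul_mul', h]
  | hW F =>
    induction B using induction_linear with
    | zero => simp only [zero_mul', mul_zero']
    | add A A' h h' => simp only [add_mul', mul_add', h, h']
    | smul c A h => simp only [smul_mul', mul_smul', h]
    | hW F' =>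
      induction C using induction_linear with
      | zero => simp only [mul_zero']
      | add A A' h h' => simp only [mul_add', h, h']
      | smul c A h => simp only [mul_smul', h]
      | hW F'' => exact W_mul_W_assoc F F' F''

theorem one_mul' (A : WeylSpan σ) : 1 * A = A := by
  induction A using induction_linear with
  | zero => simp only [mul_zero']
  | add A A' h h' => simp only [mul_add', h, h']
  | smul c A h => simp only [mul_smul', h]
  | hW F => simp [one_def, W_mul_W]

theorem mul_one' (A : WeylSpan σ) : A * 1 = A := by
  induction A using induction_linear with
  | zero => simp only [zero_mul']
  | add A A' h h' => simp only [add_mul', h, h']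
  | smul c A h => simp only [smul_mul', h]
  | hW F => simp [one_def, W_mul_W]

theorem star_star' (A : WeylSpan σ) : star (star A) = A := by
  induction A using induction_linear with
  | zero => simp only [star_zero']
  | add A A' h h' => simp only [star_add', h, h']
  | smul c A h => simp only [star_smul', h, Complex.conj_conj]
  | hW F => simp only [star_W, neg_neg]

theorem star_mul' (A B : WeylSpan σ) : star (A * B) = star B * star A := by
  induction A using induction_linear with
  | zero => simp only [zero_mul', mul_zero', star_zero']
  | add A A' h h' => simp only [add_mul', mul_add', star_add', h, h']
  | smul c A h => simp only [smul_mul', mul_smul', star_smul', h]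
  | hW F =>
    induction B using induction_linear with
    | zero => simp only [zero_mul', mul_zero', star_zero']
    | add A A' h h' => simp only [add_mul', mul_add', star_add', h, h']
    | smul c A h => simp only [smul_mul', mul_smul', star_smul', h]
    | hW F' =>
      rw [W_mul_W, star_smul', star_W, star_W, star_W, W_mul_W, ← Complex.exp_conj, neg_add_rev]
      congr 2
      simp [σ.antisymm F F', Complex.conj_ofNat]

noncomputable instance : Ring (WeylSpan σ) where
  __ := (inferInstance : AddCommGroup (WeylSpan σ))
  left_distrib := mul_add'
  right_distrib := add_mul'
  zero_mul := zero_mul'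
  mul_zero := mul_zero'
  mul_assoc := mul_assoc'
  one_mul := one_mul'
  mul_one := mul_one'

noncomputable instance : Algebra ℂ (WeylSpan σ) := Algebra.ofModule smul_mul' mul_smul'

noncomputable instance : StarRing (WeylSpan σ) where
  star_involutive := star_star'
  star_mul := star_mul'
  star_add := star_add'

instance : StarModule ℂ (WeylSpan σ) := ⟨star_smul'⟩

end Algebra

/-- Normalised, projectively positive functions `C : E → ℂ`, i.e. the characteristic functions of
states: `C(0) = 1` and `∑ᵢⱼ z̄ᵢ zⱼ exp(i σ(Fᵢ,Fⱼ) / 2) C(Fⱼ - Fᵢ) ≥ 0` (real and nonnegative). -/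
structure IsState {E : Type*} [AddCommGroup E] [Module ℝ E] (σ : PresymplecticForm E)
    (C : E → ℂ) : Prop where
  map_zero : C 0 = 1
  pos : ∀ (N : ℕ) (z : Fin N → ℂ) (F : Fin N → E),
    0 ≤ ∑ i, ∑ j, conj (z i) * z j * Complex.exp (Complex.I * (σ (F i) (F j) : ℂ) / 2)
      * C (F j - F i)

section States

variable {E : Type*} [AddCommGroup E] [Module ℝ E] {σ : PresymplecticForm E} {C : E → ℂ}

/-- The linear functional `ω_C` with `ω_C(W(F)) = C(F)`. -/
noncomputable def omega (σ : PresymplecticForm E) (C : E → ℂ) : WeylSpan σ →ₗ[ℂ] ℂ :=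
  (basis σ).constr ℂ C

theorem omega_W (F : E) : omega σ C (W σ F) = C F := by
  rw [omega, W, Module.Basis.constr_basis]

theorem star_sum_mul_sum {N : ℕ} (z : Fin N → ℂ) (F : Fin N → E) :
    star (∑ i, z i • W σ (F i)) * ∑ j, z j • W σ (F j) =
      ∑ i, ∑ j, (conj (z i) * z j * Complex.exp (Complex.I * (σ (F i) (F j) : ℂ) / 2)) •
        W σ (F j - F i) := by
  rw [star_sum, Finset.sum_mul_sum]
  refine Finset.sum_congr rfl fun i _ => Finset.sum_congr rfl fun j _ => ?_
  rw [star_smul', star_W, smul_mul', mul_smul', W_mul_W, smul_smul, smul_smul, neg_add_eq_sub]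
  congr 3
  simp only [map_neg, LinearMap.neg_apply, Complex.ofReal_neg]
  ring

theorem omega_star_sum_mul_sum {N : ℕ} (z : Fin N → ℂ) (F : Fin N → E) :
    omega σ C (star (∑ i, z i • W σ (F i)) * ∑ j, z j • W σ (F j)) =
      ∑ i, ∑ j, conj (z i) * z j * Complex.exp (Complex.I * (σ (F i) (F j) : ℂ) / 2)
        * C (F j - F i) := by
  rw [star_sum_mul_sum]
  simp only [map_sum, map_smul, omega_W, smul_eq_mul]

theorem exists_eq_sum (A : WeylSpan σ) :
    ∃ (N : ℕ) (z : Fin N → ℂ) (F : Fin N → E), Function.Injective F ∧ A = ∑ i, z i • W σ (F i) := by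
  have h := (basis σ).linearCombination_repr A
  rw [Finsupp.linearCombination_apply, Finsupp.sum] at h
  let e := ((basis σ).repr A).support.equivFin
  refine ⟨_, fun i => (basis σ).repr A (e.symm i), fun i => e.symm i,
    Subtype.val_injective.comp e.symm.injective, ?_⟩
  conv_lhs => rw [← h, ← Finset.sum_coe_sort]
  exact (e.symm.sum_comp
    (fun i : ((basis σ).repr A).support => (basis σ).repr A i • W σ (i : E))).symm

theorem isState_iff : IsState σ C ↔ C 0 = 1 ∧ ∀ A : WeylSpan σ, 0 ≤ omega σ C (star A * A) := by
  constructor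
  · rintro ⟨h0, h⟩
    refine ⟨h0, fun A => ?_⟩
    obtain ⟨N, z, F, -, rfl⟩ := exists_eq_sum A
    rw [omega_star_sum_mul_sum]
    exact h N z F
  · rintro ⟨h0, h⟩
    refine ⟨h0, fun N z F => ?_⟩
    rw [← omega_star_sum_mul_sum]
    exact h _

theorem IsState.nonneg (h : IsState σ C) (A : WeylSpan σ) : 0 ≤ omega σ C (star A * A) :=
  (isState_iff.1 h).2 A

open scoped Classical in
/-- The function `δ₀`, whose functional is the tracial state. -/
noncomputable def delta (E : Type*) [AddCommGroup E] : E → ℂ := fun F => if F = 0 then 1 else 0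

theorem omega_delta_star_mul {N : ℕ} (z : Fin N → ℂ) {F : Fin N → E}
    (hF : Function.Injective F) :
    omega σ (delta E) (star (∑ i, z i • W σ (F i)) * ∑ j, z j • W σ (F j)) =
      ((∑ i, ‖z i‖ ^ 2 : ℝ) : ℂ) := by
  rw [omega_star_sum_mul_sum, Complex.ofReal_sum]
  refine Finset.sum_congr rfl fun i _ => ?_
  rw [Finset.sum_eq_single i]
  · simp [delta, σ.alt, Complex.conj_mul']
  · intro j _ hj
    simp [delta, sub_eq_zero, hF.ne hj]
  · simp

theorem isState_delta : IsState σ (delta E) := by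
  refine isState_iff.2 ⟨by simp [delta], fun A => ?_⟩
  obtain ⟨N, z, F, hF, rfl⟩ := exists_eq_sum A
  rw [omega_delta_star_mul z hF, Complex.zero_le_real]
  positivity

theorem IsState.conj_symm (h : IsState σ C) (A B : WeylSpan σ) :
    conj (omega σ C (star B * A)) = omega σ C (star A * B) := by
  have hA := (Complex.le_def.1 (h.nonneg A)).2
  have hB := (Complex.le_def.1 (h.nonneg B)).2
  have h1 := (Complex.le_def.1 (h.nonneg (A + B))).2
  have h2 := (Complex.le_def.1 (h.nonneg (A + Complex.I • B))).2
  simp only [star_add, star_smul, add_mul, mul_add, smul_mul_assoc, mul_smul_comm, map_add,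
    map_smul, smul_eq_mul, Complex.add_im, Complex.mul_im, Complex.mul_re, Complex.I_re,
    Complex.I_im, Complex.zero_im, RCLike.star_def, Complex.conj_I, Complex.neg_re,
    Complex.neg_im] at h1 h2 hA hB
  apply Complex.ext
  · rw [Complex.conj_re]
    linarith
  · rw [Complex.conj_im]
    linarith

theorem IsState.re_nonneg (h : IsState σ C) (A : WeylSpan σ) :
    0 ≤ RCLike.re (omega σ C (star A * A)) :=
  (Complex.le_def.1 (h.nonneg A)).1

theorem IsState.add_left (_ : IsState σ C) (A B D : WeylSpan σ) :
    omega σ C (star (A + B) * D) = omega σ C (star A * D) + omega σ C (star B * D) := by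
  rw [star_add, add_mul, map_add]

theorem IsState.smul_left (_ : IsState σ C) (A B : WeylSpan σ) (c : ℂ) :
    omega σ C (star (c • A) * B) = conj c * omega σ C (star A * B) := by
  rw [star_smul, smul_mul_assoc, map_smul, smul_eq_mul, RCLike.star_def]

/-- The positive semidefinite sesquilinear form `ω_C(A^* B)`. -/
noncomputable abbrev IsState.core (h : IsState σ C) : PreInnerProductSpace.Core ℂ (WeylSpan σ) where
  inner A B := omega σ C (star A * B)
  conj_inner_symm A B := h.conj_symm A B
  re_inner_nonneg A := h.re_nonneg A
  add_left A B D := h.add_left A B D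
  smul_left A B c := h.smul_left A B c

/-- The seminorm `√ω_C(A^* A)` of a functional. -/
noncomputable def stateNorm (σ : PresymplecticForm E) (C : E → ℂ) (A : WeylSpan σ) : ℝ :=
  √(omega σ C (star A * A)).re

theorem IsState.sq_stateNorm (h : IsState σ C) (A : WeylSpan σ) :
    stateNorm σ C A ^ 2 = (omega σ C (star A * A)).re :=
  Real.sq_sqrt (Complex.le_def.1 (h.nonneg A)).1

theorem stateNorm_nonneg (A : WeylSpan σ) : 0 ≤ stateNorm σ C A := Real.sqrt_nonneg _

theorem IsState.cauchy_schwarz (h : IsState σ C) (A B : WeylSpan σ) :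
    ‖omega σ C (star A * B)‖ ≤ stateNorm σ C A * stateNorm σ C B := by
  let _ := h.core
  exact InnerProductSpace.Core.norm_inner_le_norm (𝕜 := ℂ) A B

theorem IsState.stateNorm_add_le (h : IsState σ C) (A B : WeylSpan σ) :
    stateNorm σ C (A + B) ≤ stateNorm σ C A + stateNorm σ C B := by
  let _ := h.core
  let _ : Norm (WeylSpan σ) := InnerProductSpace.Core.toNorm (𝕜 := ℂ)
  exact (InnerProductSpace.Core.toSeminormedSpaceCore h.core).norm_triangle A B

theorem IsState.stateNorm_smul (h : IsState σ C) (c : ℂ) (A : WeylSpan σ) :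
    stateNorm σ C (c • A) = ‖c‖ * stateNorm σ C A := by
  let _ := h.core
  let _ : Norm (WeylSpan σ) := InnerProductSpace.Core.toNorm (𝕜 := ℂ)
  exact (InnerProductSpace.Core.toSeminormedSpaceCore h.core).norm_smul c A

theorem IsState.stateNorm_W (h : IsState σ C) (F : E) : stateNorm σ C (W σ F) = 1 := by
  rw [stateNorm, star_W, W_mul_W, neg_add_cancel, map_smul, omega_W, h.map_zero]
  simp [σ.alt]

theorem IsState.stateNorm_sum_le (h : IsState σ C) {N : ℕ} (z : Fin N → ℂ) (F : Fin N → E) :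
    stateNorm σ C (∑ i, z i • W σ (F i)) ≤ ∑ i, ‖z i‖ := by
  have h0 : stateNorm σ C 0 = 0 := by simp [stateNorm]
  refine (Finset.le_sum_of_subadditive (stateNorm σ C) h0.le h.stateNorm_add_le _ _).trans
    (Finset.sum_le_sum fun i _ => ?_)
  rw [h.stateNorm_smul, h.stateNorm_W, mul_one]

/-- The norm `‖A‖ = sup {√ω_C(A^* A)}`, the supremum being over all states. -/
noncomputable instance : Norm (WeylSpan σ) :=
  ⟨fun A => sSup {r : ℝ | ∃ C : E → ℂ, IsState σ C ∧ r = √(omega σ C (star A * A)).re}⟩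

theorem IsState.le_norm (h : IsState σ C) (A : WeylSpan σ) : stateNorm σ C A ≤ ‖A‖ := by
  refine le_csSup ?_ ⟨C, h, rfl⟩
  obtain ⟨N, z, F, -, rfl⟩ := exists_eq_sum A
  refine ⟨∑ i, ‖z i‖, ?_⟩
  rintro _ ⟨C', h', rfl⟩
  exact h'.stateNorm_sum_le z F

theorem norm_le {A : WeylSpan σ} {r : ℝ} (h : ∀ C, IsState σ C → stateNorm σ C A ≤ r) :
    ‖A‖ ≤ r := by
  refine csSup_le ⟨_, delta E, isState_delta, rfl⟩ ?_
  rintro _ ⟨C, hC, rfl⟩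
  exact h C hC

theorem norm_nonneg' (A : WeylSpan σ) : 0 ≤ ‖A‖ :=
  (stateNorm_nonneg A).trans (isState_delta.le_norm A)

theorem eq_zero_of_norm_eq_zero {A : WeylSpan σ} (h : ‖A‖ = 0) : A = 0 := by
  have h1 : stateNorm σ (delta E) A ^ 2 = 0 := by
    rw [le_antisymm (h ▸ isState_delta.le_norm A) (stateNorm_nonneg A)]
    simp
  obtain ⟨N, z, F, hF, rfl⟩ := exists_eq_sum A
  rw [isState_delta.sq_stateNorm, omega_delta_star_mul z hF, Complex.ofReal_re,
    Finset.sum_eq_zero_iff_of_nonneg fun _ _ => sq_nonneg _] at h1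
  refine Finset.sum_eq_zero fun i hi => ?_
  have := h1 i hi
  simp only [ne_eq, OfNat.ofNat_ne_zero, not_false_eq_true, pow_eq_zero_iff, norm_eq_zero] at this
  rw [this, zero_smul]

/-- If `ω_C(B^* B) > 0`, then `X ↦ ω_C(B^* X B) / ω_C(B^* B)` is a state. -/
theorem IsState.exists_conj (h : IsState σ C) {B : WeylSpan σ}
    (hB : 0 < (omega σ C (star B * B)).re) :
    ∃ C', IsState σ C' ∧ ∀ X, omega σ C' X =
      ((omega σ C (star B * B)).re : ℂ)⁻¹ * omega σ C (star B * X * B) := by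
  set t := (omega σ C (star B * B)).re with ht
  have hX : ∀ X, omega σ (fun F => (t : ℂ)⁻¹ * omega σ C (star B * W σ F * B)) X =
      (t : ℂ)⁻¹ * omega σ C (star B * X * B) := by
    intro X
    induction X using induction_linear with
    | zero => simp
    | add X Y hX hY => simp only [map_add, mul_add, add_mul, hX, hY]
    | smul c X hX =>
      simp only [map_smul, mul_smul_comm, smul_mul_assoc, hX, smul_eq_mul]
      ring
    | hW F => rw [omega_W]
  refine ⟨_, isState_iff.2 ⟨?_, fun A => ?_⟩, hX⟩
  · have h0 : omega σ C (star B * B) = (t : ℂ) :=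
      Complex.ext rfl (by simpa using (Complex.le_def.1 (h.nonneg B)).2.symm)
    change (t : ℂ)⁻¹ * omega σ C (star B * 1 * B) = 1
    rw [mul_one, h0, inv_mul_cancel₀]
    exact_mod_cast hB.ne'
  · rw [hX]
    have h1 := h.nonneg (A * B)
    rw [star_mul, mul_assoc, ← mul_assoc (star A), ← mul_assoc] at h1
    refine mul_nonneg ?_ h1
    rw [← Complex.ofReal_inv, Complex.zero_le_real]
    positivity

theorem IsState.stateNorm_mul_le (h : IsState σ C) (A B : WeylSpan σ) :
    stateNorm σ C (A * B) ≤ ‖A‖ * stateNorm σ C B := by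
  have e : star (A * B) * (A * B) = star B * (star A * A) * B := by
    simp only [star_mul, mul_assoc]
  rcases (stateNorm_nonneg (C := C) B).eq_or_lt with hB | hB
  · have h1 := h.cauchy_schwarz B (star A * A * B)
    rw [← hB, zero_mul, ← mul_assoc, ← e, norm_le_zero_iff] at h1
    rw [stateNorm, h1, ← hB]
    simp
  · have hB' : 0 < (omega σ C (star B * B)).re := by
      rw [← h.sq_stateNorm]
      positivity
    obtain ⟨C', h', hC'⟩ := h.exists_conj hB'
    have h1 := h'.sq_stateNorm A
    rw [hC', ← e, ← Complex.ofReal_inv, Complex.re_ofReal_mul, ← h.sq_stateNorm,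
      ← h.sq_stateNorm] at h1
    have h2 : stateNorm σ C (A * B) ^ 2 = (stateNorm σ C' A * stateNorm σ C B) ^ 2 := by
      rw [mul_pow, h1]
      field_simp
    rw [sq_eq_sq₀ (stateNorm_nonneg _) (mul_nonneg (stateNorm_nonneg _) hB.le)] at h2
    rw [h2]
    exact mul_le_mul_of_nonneg_right (h'.le_norm A) hB.le

/-- The supremum over the states, as a ring norm. -/
noncomputable def ringNorm (σ : PresymplecticForm E) : RingNorm (WeylSpan σ) where
  toFun A := ‖A‖
  map_zero' := le_antisymm (norm_le fun C hC => by simp [stateNorm]) (norm_nonneg' 0)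
  add_le' A B := norm_le fun C hC =>
    (hC.stateNorm_add_le A B).trans (add_le_add (hC.le_norm A) (hC.le_norm B))
  neg' A := by
    change sSup _ = sSup _
    simp only [star_neg, neg_mul_neg]
  mul_le' A B := norm_le fun C hC => (hC.stateNorm_mul_le A B).trans
    (mul_le_mul_of_nonneg_left (hC.le_norm B) (norm_nonneg' A))
  eq_zero_of_map_eq_zero' _ := eq_zero_of_norm_eq_zero

noncomputable instance : NormedRing (WeylSpan σ) where
  __ := (inferInstance : Norm (WeylSpan σ))
  __ := (inferInstance : Ring (WeylSpan σ))
  __ := (ringNorm σ).toNormedRing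

noncomputable instance : NormedAlgebra ℂ (WeylSpan σ) where
  norm_smul_le c A := norm_le fun C hC => by
    rw [hC.stateNorm_smul]
    exact mul_le_mul_of_nonneg_left (hC.le_norm A) (norm_nonneg c)

instance : CStarRing (WeylSpan σ) where
  norm_mul_self_le A := by
    have h0 : 0 ≤ ‖star A * A‖ := norm_nonneg _
    have : ‖A‖ ≤ √‖star A * A‖ := by
      refine norm_le fun C hC => Real.le_sqrt_of_sq_le ?_
      rw [hC.sq_stateNorm]
      have h1 := hC.cauchy_schwarz 1 (star A * A)
      have h2 : stateNorm σ C 1 = 1 := hC.stateNorm_W 0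
      rw [star_one, one_mul, h2, one_mul] at h1
      exact (Complex.re_le_norm _).trans (h1.trans (hC.le_norm _))
    calc ‖A‖ * ‖A‖ ≤ √‖star A * A‖ * √‖star A * A‖ :=
          mul_self_le_mul_self (norm_nonneg _) this
      _ = ‖star A * A‖ := Real.mul_self_sqrt h0

end States

end WeylSpan

/-- The Weyl algebra `𝒲(E, σ)`: the completion of the span of the Weyl elements with respect to the
`C*`-norm `‖A‖ = sup {√ω_C(A^* A)}`. -/
def WeylAlgebra {E : Type*} [AddCommGroup E] [Module ℝ E] (σ : PresymplecticForm E) : Type _ :=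
  UniformSpace.Completion (WeylSpan σ)

namespace WeylAlgebra

open UniformSpace

variable {E : Type*} [AddCommGroup E] [Module ℝ E] {σ : PresymplecticForm E}

noncomputable instance : NormedRing (WeylAlgebra σ) :=
  inferInstanceAs (NormedRing (Completion (WeylSpan σ)))

noncomputable instance : Algebra ℂ (WeylAlgebra σ) :=
  inferInstanceAs (Algebra ℂ (Completion (WeylSpan σ)))

noncomputable instance : NormedAlgebra ℂ (WeylAlgebra σ) where
  norm_smul_le := norm_smul_le (α := ℂ) (β := Completion (WeylSpan σ))

instance : CompleteSpace (WeylAlgebra σ) :=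
  inferInstanceAs (CompleteSpace (Completion (WeylSpan σ)))

/-- The canonical embedding of the span of the Weyl elements. -/
noncomputable def of (σ : PresymplecticForm E) : WeylSpan σ →ₐ[ℂ] WeylAlgebra σ where
  __ := (Completion.coeRingHom : WeylSpan σ →+* Completion (WeylSpan σ))
  commutes' _ := rfl

/-- The Weyl element `W(F)` in the Weyl algebra. -/
noncomputable def W (σ : PresymplecticForm E) (F : E) : WeylAlgebra σ := of σ (WeylSpan.W σ F)

theorem norm_of (A : WeylSpan σ) : ‖of σ A‖ = ‖A‖ := Completion.norm_coe A

theorem denseRange_of : DenseRange (of σ) := Completion.denseRange_coe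

theorem continuous_of : Continuous (of σ) := Completion.continuous_coe _

/-- The involution extends by continuity. -/
noncomputable instance : Star (WeylAlgebra σ) :=
  ⟨Completion.map (star : WeylSpan σ → WeylSpan σ)⟩

theorem continuous_star' : Continuous (star : WeylAlgebra σ → WeylAlgebra σ) :=
  Completion.continuous_map

theorem star_of (A : WeylSpan σ) : star (of σ A) = of σ (star A) :=
  Completion.map_coe (starₗᵢ ℂ : WeylSpan σ ≃ₗᵢ⋆[ℂ] WeylSpan σ).isometry.uniformContinuous A

@[elab_as_elim]
theorem induction_of {p : WeylAlgebra σ → Prop} (A : WeylAlgebra σ) (hp : IsClosed {A | p A})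
    (h : ∀ A, p (of σ A)) : p A :=
  Completion.induction_on A hp h

theorem star_add' (A B : WeylAlgebra σ) : star (A + B) = star A + star B := by
  have hs := continuous_star' (σ := σ)
  refine induction_of A (isClosed_eq (by fun_prop) (by fun_prop)) fun A => ?_
  refine induction_of B (isClosed_eq (by fun_prop) (by fun_prop)) fun B => ?_
  rw [← map_add, star_of, star_of, star_of, star_add, map_add]

theorem star_mul' (A B : WeylAlgebra σ) : star (A * B) = star B * star A := by
  have hs := continuous_star' (σ := σ)
  refine induction_of A (isClosed_eq (by fun_prop) (by fun_prop)) fun A => ?_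
  refine induction_of B (isClosed_eq (by fun_prop) (by fun_prop)) fun B => ?_
  rw [← map_mul, star_of, star_of, star_of, star_mul, map_mul]

theorem star_star' (A : WeylAlgebra σ) : star (star A) = A := by
  have hs := continuous_star' (σ := σ)
  refine induction_of A (isClosed_eq (by fun_prop) (by fun_prop)) fun A => ?_
  rw [star_of, star_of, star_star]

noncomputable instance : StarRing (WeylAlgebra σ) where
  star_involutive := star_star'
  star_add := star_add'
  star_mul := star_mul'

instance : StarModule ℂ (WeylAlgebra σ) where
  star_smul c A := by
    have hs := continuous_star' (σ := σ)
    refine induction_of A (isClosed_eq (hs.comp (continuous_const_smul c))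
      (hs.const_smul (star c))) fun A => ?_
    rw [← map_smul, star_of, star_of, star_smul, map_smul]

instance : CStarRing (WeylAlgebra σ) where
  norm_mul_self_le A := by
    have hs := continuous_star' (σ := σ)
    refine induction_of A (isClosed_le (by fun_prop) (by fun_prop)) fun A => ?_
    rw [star_of, ← map_mul, norm_of, norm_of, CStarRing.norm_star_mul_self]

noncomputable instance : CStarAlgebra (WeylAlgebra σ) where

theorem W_mul_W (F F' : E) :
    W σ F * W σ F' = Complex.exp (-(Complex.I * (σ F F' : ℂ) / 2)) • W σ (F + F') := by
  rw [W, W, ← map_mul, WeylSpan.W_mul_W, map_smul, W]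

theorem star_W (F : E) : star (W σ F) = W σ (-F) := by
  rw [W, star_of, WeylSpan.star_W, W]

end WeylAlgebra

/-- A continuous field of `C*`-algebras `({A x}ₓ, K)` over a topological space `X`: `K` is a sub
`*`-algebra of the product `∏ₓ A x` (a set of sections `x ↦ k x ∈ A x`) such that the norm of every
section in `K` is continuous, `K` is pointwise dense, and `K` contains every section which is
locally uniformly approximable by sections in `K`. -/
structure IsContinuousField {X : Type*} [TopologicalSpace X] (A : X → Type*)
    [∀ x, NonUnitalCStarAlgebra (A x)] (K : NonUnitalStarSubalgebra ℂ (∀ x, A x)) : Prop where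
  continuous_norm : ∀ k ∈ K, Continuous fun x => ‖k x‖
  dense : ∀ x, Dense {a : A x | ∃ k ∈ K, k x = a}
  mem_of_locally_approx : ∀ k : (∀ x, A x),
    (∀ x₀ : X, ∀ ε : ℝ, 0 < ε → ∃ h ∈ K, ∃ U ∈ nhds x₀, ∀ x ∈ U, ‖k x - h x‖ < ε) → k ∈ K

/-!
The closure of the span of the Weyl sections under local uniform approximation in norm is
the only candidate for the field: every continuous field containing the Weyl sections contains it,
and conversely a section of such a field which is close to a combination of Weyl sections at a point
is close to it near that point, as the norm of their difference is continuous. It is a continuous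
field as soon as the norms of the combinations of Weyl sections with constant coefficients are
continuous; the product of two Weyl sections has a variable but continuous phase, so that it is again
locally approximated by such combinations (`existsUnique_isContinuousField`, `weylSection_mul_mem`).

The continuity of `m ↦ ‖∑ₖ aₖ Wₘ(Fₖ)‖` is the analytic core (`WeylSpan.tendsto_norm`).

* Upper semicontinuity: the characteristic functions of states take values in the unit disc, so almost
  optimal states converge pointwise along an ultrafilter, and positivity for `Gₘ` passes to the limit.
* Lower semicontinuity: if `C` is a state for `Gₘ₀` and `D` is one for the form `Gₘ - Gₘ₀`, then `C D`
  is a state for `Gₘ` by the product theorem of Schur (`Matrix.PosSemidef.projKernel_add`). It remains to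
  find such `D` tending to `1` on a given finite set as `m → m₀`
  (`exists_projKernel_tendsto_one`). On a finite-dimensional space, with coordinates `fₖ`, the form
  is a sum of forms `t (fₖ ∧ fₗ)`, for which the Gaussian `exp(-|t| (fₖ² + fₗ²) / 4)` is projectively
  positive, as seen from the kernel `exp(s w̄ w')`; the product of these Gaussians tends to `1` as the
  coefficients `t` tend to `0`. Extended by `0` from the subspace it remains projectively positive for
  the form on the whole space, whatever the dimension of the latter.
-/

/-! ### Continuous fields generated by a space of sections -/

section LocalClosure

open Filter Topology

variable {X : Type*} [TopologicalSpace X] {A : X → Type*} [∀ x, NonUnitalCStarAlgebra (A x)]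

/-- The sections which are, near every point and up to every `ε > 0`, uniformly approximated by
sections in `Γ`. -/
def localClosure (Γ : Submodule ℂ (∀ x, A x)) : Submodule ℂ (∀ x, A x) where
  carrier := {k | ∀ x₀, ∀ ε : ℝ, 0 < ε → ∃ h ∈ Γ, ∀ᶠ x in 𝓝 x₀, ‖k x - h x‖ < ε}
  zero_mem' x₀ ε hε := ⟨0, Γ.zero_mem, Eventually.of_forall fun x => by simpa using hε⟩
  add_mem' := by
    intro k k' hk hk' x₀ ε hε
    obtain ⟨h, hh, H⟩ := hk x₀ (ε / 2) (by positivity)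
    obtain ⟨h', hh', H'⟩ := hk' x₀ (ε / 2) (by positivity)
    refine ⟨h + h', Γ.add_mem hh hh', ?_⟩
    filter_upwards [H, H'] with x hx hx'
    rw [Pi.add_apply, Pi.add_apply, add_sub_add_comm]
    linarith [norm_add_le (k x - h x) (k' x - h' x)]
  smul_mem' := by
    intro c k hk x₀ ε hε
    obtain ⟨h, hh, H⟩ := hk x₀ (ε / (‖c‖ + 1)) (by positivity)
    refine ⟨c • h, Γ.smul_mem c hh, ?_⟩
    filter_upwards [H] with x hx
    rw [Pi.smul_apply, Pi.smul_apply, ← smul_sub, norm_smul]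
    rw [lt_div_iff₀ (by positivity)] at hx
    nlinarith [norm_nonneg (k x - h x)]

variable {Γ : Submodule ℂ (∀ x, A x)} {k k' : ∀ x, A x}

theorem mem_localClosure : k ∈ localClosure Γ ↔
    ∀ x₀, ∀ ε : ℝ, 0 < ε → ∃ h ∈ Γ, ∀ᶠ x in 𝓝 x₀, ‖k x - h x‖ < ε := Iff.rfl

theorem le_localClosure : Γ ≤ localClosure Γ := fun k hk _ ε hε =>
  ⟨k, hk, Eventually.of_forall fun x => by simpa using hε⟩

/-- Local uniform approximation can be iterated. -/
theorem mem_localClosure_of_approx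
    (hk : ∀ x₀, ∀ ε : ℝ, 0 < ε → ∃ h ∈ localClosure Γ, ∀ᶠ x in 𝓝 x₀, ‖k x - h x‖ < ε) :
    k ∈ localClosure Γ := by
  intro x₀ ε hε
  obtain ⟨h, hh, H⟩ := hk x₀ (ε / 2) (by positivity)
  obtain ⟨h', hh', H'⟩ := hh x₀ (ε / 2) (by positivity)
  refine ⟨h', hh', ?_⟩
  filter_upwards [H, H'] with x hx hx'
  rw [← sub_add_sub_cancel _ (h x)]
  linarith [norm_add_le (k x - h x) (h x - h' x)]

theorem continuous_norm_of_mem_localClosure (hΓ : ∀ h ∈ Γ, Continuous fun x => ‖h x‖)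
    (hk : k ∈ localClosure Γ) : Continuous fun x => ‖k x‖ := by
  refine continuous_iff_continuousAt.2 fun x₀ => Metric.continuousAt_iff'.2 fun ε hε => ?_
  obtain ⟨h, hh, H⟩ := hk x₀ (ε / 3) (by positivity)
  filter_upwards [H, Metric.continuousAt_iff'.1 (hΓ h hh).continuousAt (ε / 3) (by positivity)]
    with x hx hx'
  have h1 := abs_lt.1 ((abs_norm_sub_norm_le (k x) (h x)).trans_lt hx)
  have h2 := abs_lt.1 ((abs_norm_sub_norm_le (k x₀) (h x₀)).trans_lt H.self_of_nhds)
  rw [Real.dist_eq, abs_lt] at hx' ⊢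
  constructor <;> linarith [h1.1, h1.2, h2.1, h2.2, hx'.1, hx'.2]

theorem star_mem_localClosure (hstar : ∀ h ∈ Γ, star h ∈ localClosure Γ)
    (hk : k ∈ localClosure Γ) : star k ∈ localClosure Γ := by
  refine mem_localClosure_of_approx fun x₀ ε hε => ?_
  obtain ⟨h, hh, H⟩ := hk x₀ ε hε
  refine ⟨star h, hstar h hh, ?_⟩
  filter_upwards [H] with x hx
  rwa [Pi.star_apply, Pi.star_apply, ← star_sub, norm_star]

theorem mul_mem_localClosure (hΓ : ∀ h ∈ Γ, Continuous fun x => ‖h x‖)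
    (hmul : ∀ h ∈ Γ, ∀ h' ∈ Γ, h * h' ∈ localClosure Γ)
    (hk : k ∈ localClosure Γ) (hk' : k' ∈ localClosure Γ) : k * k' ∈ localClosure Γ := by
  refine mem_localClosure_of_approx fun x₀ ε hε => ?_
  set M := ‖k x₀‖ + ‖k' x₀‖ + 2 with hM
  have hM2 : 2 ≤ M := by linarith [norm_nonneg (k x₀), norm_nonneg (k' x₀)]
  have hδ : 0 < min 1 (ε / (2 * M)) := by positivity
  obtain ⟨h, hh, H⟩ := hk x₀ _ hδ
  obtain ⟨h', hh', H'⟩ := hk' x₀ _ hδ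
  have B : ∀ᶠ x in 𝓝 x₀, ‖k x‖ < ‖k x₀‖ + 1 :=
    (continuous_norm_of_mem_localClosure hΓ hk).continuousAt.eventually_lt_const (by linarith)
  have B' : ∀ᶠ x in 𝓝 x₀, ‖k' x‖ < ‖k' x₀‖ + 1 :=
    (continuous_norm_of_mem_localClosure hΓ hk').continuousAt.eventually_lt_const (by linarith)
  refine ⟨h * h', hmul h hh h' hh', ?_⟩
  filter_upwards [H, H', B, B'] with x hx hx' hb hb'
  have e : (k * k') x - (h * h') x = k x * (k' x - h' x) + (k x - h x) * h' x := by
    simp only [Pi.mul_apply, mul_sub, sub_mul]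
    abel
  have hh'M : ‖h' x‖ ≤ M := by
    have := norm_sub_norm_le (h' x) (k' x)
    rw [norm_sub_rev] at this
    linarith [hx'.trans_le (min_le_left _ _), norm_nonneg (k x₀)]
  have hkM : ‖k x‖ ≤ M := by linarith [norm_nonneg (k' x₀)]
  have hx := hx.trans_le (min_le_right _ _)
  have hx' := hx'.trans_le (min_le_right _ _)
  rw [lt_div_iff₀ (by positivity)] at hx hx'
  rw [e]
  have h1 := (norm_mul_le (k x) (k' x - h' x)).trans
    (mul_le_mul_of_nonneg_right hkM (norm_nonneg _))
  have h2 := (norm_mul_le (k x - h x) (h' x)).trans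
    (mul_le_mul_of_nonneg_left hh'M (norm_nonneg _))
  have h3 := norm_add_le (k x * (k' x - h' x)) ((k x - h x) * h' x)
  linarith

/-- A space of sections with continuous norms which is pointwise dense, and closed under products
and adjoints up to local uniform approximation, lies in exactly one continuous field of
`C*`-algebras, namely its local closure. -/
theorem existsUnique_isContinuousField (hΓ : ∀ h ∈ Γ, Continuous fun x => ‖h x‖)
    (hdense : ∀ x, Dense {a : A x | ∃ h ∈ Γ, h x = a})
    (hmul : ∀ h ∈ Γ, ∀ h' ∈ Γ, h * h' ∈ localClosure Γ)
    (hstar : ∀ h ∈ Γ, star h ∈ localClosure Γ) :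
    ∃! K : NonUnitalStarSubalgebra ℂ (∀ x, A x), IsContinuousField A K ∧ ∀ h ∈ Γ, h ∈ K := by
  refine ⟨{ localClosure Γ with
      mul_mem' := mul_mem_localClosure hΓ hmul
      star_mem' := star_mem_localClosure hstar }, ⟨⟨?_, ?_, ?_⟩, ?_⟩, ?_⟩
  · exact fun k hk => continuous_norm_of_mem_localClosure hΓ hk
  · refine fun x => (hdense x).mono ?_
    rintro a ⟨h, hh, rfl⟩
    exact ⟨h, le_localClosure hh, rfl⟩
  · intro k hk
    refine mem_localClosure_of_approx fun x₀ ε hε => ?_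
    obtain ⟨h, hh, U, hU, H⟩ := hk x₀ ε hε
    exact ⟨h, hh, eventually_of_mem hU H⟩
  · exact fun h hh => le_localClosure hh
  · rintro K ⟨hK, hΓK⟩
    refine SetLike.ext fun k => ⟨fun hk => ?_, fun hk => ?_⟩
    · -- A section of `K` which is small at a point is small near it, by continuity of its norm.
      refine (mem_localClosure (Γ := Γ)).2 fun x₀ ε hε => ?_
      obtain ⟨_, H, h, hh, rfl⟩ := Metric.dense_iff.1 (hdense x₀) (k x₀) ε hε
      refine ⟨h, hh, (hK.continuous_norm _ (sub_mem hk (hΓK h hh))).continuousAt.eventually_lt_const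
        ?_⟩
      rw [Metric.mem_ball, dist_comm, dist_eq_norm] at H
      exact H
    · refine hK.mem_of_locally_approx k fun x₀ ε hε => ?_
      obtain ⟨h, hh, H⟩ := (mem_localClosure (Γ := Γ)).1 hk x₀ ε hε
      exact ⟨h, hΓK h hh, _, H, fun x hx => hx⟩

end LocalClosure

/-! ### Positive semidefinite kernels -/

namespace Matrix

variable {n : Type*}

theorem posSemidef_conj_mul (a : n → ℂ) :
    (of fun i j => conj (a i) * a j : Matrix n n ℂ).PosSemidef := by
  refine ⟨Matrix.ext fun i j => by simp [mul_comm], fun x => ?_⟩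
  have e : (x.sum fun i xi => x.sum fun j xj =>
      star xi * (of fun i j => conj (a i) * a j : Matrix n n ℂ) i j * xj) =
      star (x.sum fun i xi => a i * xi) * x.sum fun i xi => a i * xi := by
    simp only [Finsupp.sum, star_sum, Finset.sum_mul_sum]
    refine Finset.sum_congr rfl fun i _ => Finset.sum_congr rfl fun j _ => ?_
    simp only [of_apply, star_mul', RCLike.star_def]
    ring
  rw [e]
  exact star_mul_self_nonneg _

/-- Schur's product theorem, for the partial order and the star structure of `ℂ` itself instead of
those that it has as an `RCLike` field. -/
theorem PosSemidef.hadamard_complex {A B : Matrix n n ℂ} (hA : A.PosSemidef) (hB : B.PosSemidef) :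
    (A.hadamard B).PosSemidef := hA.hadamard hB

theorem PosSemidef.of_tendsto {ι : Type*} {l : Filter ι} [l.NeBot] {M : ι → Matrix n n ℂ}
    {M₀ : Matrix n n ℂ} (hM : ∀ k, (M k).PosSemidef)
    (h : ∀ i j, Filter.Tendsto (fun k => M k i j) l (nhds (M₀ i j))) : M₀.PosSemidef := by
  refine ⟨Matrix.ext fun i j => ?_, fun x => ?_⟩
  · refine tendsto_nhds_unique ((continuous_star.tendsto _).comp (h j i)) ((h i j).congr fun k => ?_)
    exact ((hM k).1.apply i j).symm
  · refine ge_of_tendsto' (f := fun k => x.sum fun i xi => x.sum fun j xj =>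
      star xi * M k i j * xj) (x := l) ?_ fun k => (hM k).2 x
    exact tendsto_finsetSum _ fun i _ => tendsto_finsetSum _ fun j _ =>
      ((h i j).const_mul _).mul_const _

/-- The exponential series writes the kernel as a limit of sums of kernels of rank one. -/
theorem posSemidef_exp_conj_mul {s : ℝ} (hs : 0 ≤ s) (a : n → ℂ) :
    (of fun i j => Complex.exp (s * (conj (a i) * a j)) : Matrix n n ℂ).PosSemidef := by
  refine PosSemidef.of_tendsto (l := Filter.atTop)
    (M := fun N : ℕ => ∑ k ∈ Finset.range N,
      ((s ^ k / k.factorial : ℝ) : ℂ) • of fun i j => conj (a i ^ k) * a j ^ k) (fun N => ?_)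
    fun i j => ?_
  · refine posSemidef_sum _ fun k _ => (posSemidef_conj_mul fun i => a i ^ k).smul ?_
    rw [Complex.zero_le_real]
    positivity
  · have h := (NormedSpace.expSeries_div_hasSum_exp ((s : ℂ) * (conj (a i) * a j))).tendsto_sum_nat
    rw [← Complex.exp_eq_exp_ℂ] at h
    refine h.congr fun N => ?_
    simp only [sum_apply, smul_apply, of_apply, smul_eq_mul]
    refine Finset.sum_congr rfl fun k _ => ?_
    push_cast
    rw [map_pow]
    ring

end Matrix

section Kernel

variable {E : Type*} [AddCommGroup E]

/-- The kernel `(F, F') ↦ exp(i τ(F,F') / 2) C(F' - F)`, whose positivity expresses that `C` is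
projectively positive with respect to `τ`. Here `τ` may be any function of two variables. -/
noncomputable def projKernel (τ : E → E → ℝ) (C : E → ℂ) : Matrix E E ℂ :=
  Matrix.of fun F F' => Complex.exp (Complex.I * (τ F F' : ℂ) / 2) * C (F' - F)

theorem projKernel_apply (τ : E → E → ℝ) (C : E → ℂ) (F F' : E) :
    projKernel τ C F F' = Complex.exp (Complex.I * (τ F F' : ℂ) / 2) * C (F' - F) := rfl

/-- By Schur's product theorem, projectively positive functions can be multiplied, at the price of
adding the forms. -/
theorem Matrix.PosSemidef.projKernel_add {τ τ' : E → E → ℝ} {C D : E → ℂ}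
    (hC : (projKernel τ C).PosSemidef) (hD : (projKernel τ' D).PosSemidef) :
    (projKernel (τ + τ') (C * D)).PosSemidef := by
  convert hC.hadamard_complex hD using 1
  ext F F'
  simp only [Matrix.hadamard_apply, projKernel_apply, Pi.add_apply, Pi.mul_apply]
  rw [Complex.ofReal_add, mul_add, add_div, Complex.exp_add]
  ring

theorem posSemidef_projKernel_sum {κ : Type*} (s : Finset κ) {τ : κ → E → E → ℝ} {q : κ → E → ℝ}
    (h : ∀ k, (projKernel (τ k) fun F => (Real.exp (q k F) : ℂ)).PosSemidef) :
    (projKernel (∑ k ∈ s, τ k) fun F => (Real.exp (∑ k ∈ s, q k F) : ℂ)).PosSemidef := by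
  classical
  induction s using Finset.induction_on with
  | empty =>
    convert Matrix.posSemidef_conj_mul (fun _ : E => 1) using 1
    ext F F'
    simp [projKernel_apply]
  | insert k s hk ih =>
    convert (h k).projKernel_add ih using 1
    rw [Finset.sum_insert hk]
    congr 1
    funext F
    rw [Finset.sum_insert hk, Pi.mul_apply, Real.exp_add, Complex.ofReal_mul]

variable [Module ℝ E]

namespace WeylSpan

variable {σ : PresymplecticForm E} {C : E → ℂ}

theorem omega_star_W_mul_W (F F' : E) :
    omega σ C (star (W σ F) * W σ F') = projKernel (fun F F' => σ F F') C F F' := by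
  rw [star_W, W_mul_W, map_smul, omega_W, smul_eq_mul, neg_add_eq_sub, projKernel_apply]
  congr 2
  simp only [map_neg, LinearMap.neg_apply, Complex.ofReal_neg]
  ring

theorem omega_star_mul_self (a : E →₀ ℂ) :
    omega σ C (star ((basis σ).repr.symm a) * (basis σ).repr.symm a) =
      a.sum fun F z => a.sum fun F' z' =>
        star z * projKernel (fun F F' => σ F F') C F F' * z' := by
  rw [Module.Basis.repr_symm_apply, Finsupp.linearCombination_apply]
  simp only [Finsupp.sum, star_sum, Finset.sum_mul_sum, map_sum]
  refine Finset.sum_congr rfl fun F _ => Finset.sum_congr rfl fun F' _ => ?_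
  rw [star_smul, smul_mul_smul_comm, map_smul, smul_eq_mul]
  change _ * omega σ C (star (W σ F) * W σ F') = _
  rw [omega_star_W_mul_W]
  ring

theorem isState_iff_posSemidef :
    IsState σ C ↔ C 0 = 1 ∧ (projKernel (fun F F' => σ F F') C).PosSemidef := by
  refine ⟨fun h => ⟨h.map_zero, Matrix.ext fun F F' => ?_, fun a => ?_⟩,
    fun ⟨h0, h⟩ => isState_iff.2 ⟨h0, fun A => ?_⟩⟩
  · rw [Matrix.conjTranspose_apply, ← omega_star_W_mul_W, ← omega_star_W_mul_W]
    exact h.conj_symm _ _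
  · rw [← omega_star_mul_self]
    exact h.nonneg _
  · obtain ⟨a, rfl⟩ := (basis σ).repr.symm.surjective A
    rw [omega_star_mul_self]
    exact h.2 a

theorem IsState.norm_le_one (h : IsState σ C) (F : E) : ‖C F‖ ≤ 1 := by
  have h1 := h.cauchy_schwarz 1 (W σ F)
  rwa [star_one, one_mul, omega_W, one_def, h.stateNorm_W, h.stateNorm_W, one_mul] at h1

end WeylSpan

/-! ### Gaussian states supported on finite-dimensional subspaces -/

/-- With `w = f + i g` for `t ≥ 0`, `w = f - i g` for `t < 0`, the kernel is
`exp(|t| conj(w(F)) w(F') / 2)` up to real factors depending on `F` or `F'` alone. -/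
theorem posSemidef_projKernel_gaussian (t : ℝ) (f g : E →ₗ[ℝ] ℝ) :
    (projKernel (fun F F' => t * (f F * g F' - g F * f F'))
      fun F => (Real.exp (-(|t| * (f F ^ 2 + g F ^ 2) / 4)) : ℂ)).PosSemidef := by
  obtain ⟨u, hu, hut⟩ : ∃ u : ℝ, u ^ 2 = 1 ∧ t = u * |t| := by
    rcases le_total 0 t with h | h
    · exact ⟨1, by norm_num, by rw [abs_of_nonneg h, one_mul]⟩
    · exact ⟨-1, by norm_num, by rw [abs_of_nonpos h]; ring⟩
  have h1 := Matrix.posSemidef_exp_conj_mul (s := |t| / 2) (by positivity)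
    fun F => (f F + Complex.I * (u * g F) : ℂ)
  have h2 := Matrix.posSemidef_conj_mul
    fun F => Complex.exp (-(|t| * (f F ^ 2 + g F ^ 2) / 4 : ℝ))
  convert h1.hadamard_complex h2 using 1
  ext F F'
  have hI := Complex.I_sq
  have hu' : (u : ℂ) ^ 2 = 1 := by exact_mod_cast hu
  have ht' : (t : ℂ) = u * (|t| : ℝ) := by exact_mod_cast hut
  rw [Matrix.hadamard_apply, Matrix.of_apply, Matrix.of_apply, projKernel_apply, Complex.ofReal_exp,
    ← Complex.exp_conj, ← Complex.exp_add, ← Complex.exp_add, ← Complex.exp_add]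
  congr 1
  simp only [map_sub, map_neg, map_add, map_mul, Complex.conj_ofReal, Complex.conj_I]
  push_cast
  rw [ht']
  linear_combination (((|t| : ℝ) : ℂ) / 2 * u ^ 2 * g F * g F') * hI
    + ((|t| : ℝ) : ℂ) / 4 * ((g F - g F') ^ 2 - g F ^ 2 - g F' ^ 2) * hu'

/-- A projectively positive function for the compression of `τ` by a linear map `P` becomes one for
`τ` itself when it is cut off outside the fixed points of `P`. -/
theorem posSemidef_projKernel_cutoff [DecidableEq E] (τ : E →ₗ[ℝ] E →ₗ[ℝ] ℝ)
    (hτ : ∀ F F', τ F' F = -τ F F') (P : E →ₗ[ℝ] E) {C : E → ℂ}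
    (hC : (projKernel (fun F F' => τ (P F) (P F')) C).PosSemidef) :
    (projKernel (fun F F' => τ F F') fun F => if P F = F then C F else 0).PosSemidef := by
  -- `P` fixes `F' - F` exactly if `F` and `F'` have the same component `F - P F`. In that case `τ`
  -- and its compression differ by a coboundary, which is a kernel of rank one.
  have h1 : (Matrix.of fun F F' : E => if F - P F = F' - P F' then (1 : ℂ) else 0).PosSemidef :=
    (Matrix.PosSemidef.one (n := E) (R := ℂ)).submatrix fun F => F - P F
  have h2 := Matrix.posSemidef_conj_mul
    fun F => Complex.exp (Complex.I * (τ (F - P F) (P F) : ℝ) / 2)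
  convert (h1.hadamard_complex h2).hadamard_complex hC using 1
  ext F F'
  simp only [Matrix.hadamard_apply, Matrix.of_apply, projKernel_apply]
  have e : P (F' - F) = F' - F ↔ F - P F = F' - P F' := by
    rw [map_sub, sub_eq_sub_iff_add_eq_add, sub_eq_sub_iff_add_eq_add]
    constructor <;> intro h
    · rw [add_comm F, ← h, add_comm]
    · rw [add_comm, ← h, add_comm]
  by_cases h : F - P F = F' - P F'
  · rw [if_pos (e.2 h), if_pos h, ← Complex.exp_conj, one_mul, ← mul_assoc, ← Complex.exp_add,
      ← Complex.exp_add]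
    congr 2
    simp only [map_div₀, map_mul, Complex.conj_I, Complex.conj_ofReal, Complex.conj_ofNat]
    have h3 : τ F F' = -τ (F - P F) (P F) + τ (F' - P F') (P F') + τ (P F) (P F') := by
      have h0 : τ (F - P F) (F - P F) = 0 := by linarith [hτ (F - P F) (F - P F)]
      have hF : F = (F - P F) + P F := by abel
      have hF' : F' = (F - P F) + P F' := by rw [h]; abel
      have h4 : τ F F' = τ ((F - P F) + P F) ((F - P F) + P F') := by rw [← hF, ← hF']
      rw [h4, map_add τ, LinearMap.add_apply, map_add, map_add, h0, hτ (F - P F) (P F), ← h]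
      ring
    rw [h3]
    push_cast
    ring
  · rw [if_neg (mt e.1 h), if_neg h]
    simp

end Kernel

section Norm

open Filter Topology

variable {E : Type*} [AddCommGroup E] [Module ℝ E]

/-- Forms which tend to `0` pointwise have projectively positive normalised functions which tend to
`1` on a given finite set: Gaussians on the span of finitely many vectors of a Hamel basis, which
contains the given set, extended by `0`. -/
theorem exists_projKernel_tendsto_one {X : Type*} {l : Filter X} (τ : X → E →ₗ[ℝ] E →ₗ[ℝ] ℝ)
    (hτ : ∀ x F F', τ x F' F = -τ x F F') (hl : ∀ F F', Tendsto (fun x => τ x F F') l (𝓝 0))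
    (S : Finset E) :
    ∃ D : X → E → ℂ, (∀ x, D x 0 = 1 ∧ (projKernel (fun F F' => τ x F F') (D x)).PosSemidef) ∧
      ∀ F ∈ S, Tendsto (fun x => D x F) l (𝓝 1) := by
  classical
  let b := Module.Basis.ofVectorSpace ℝ E
  let T := S.biUnion fun F => (b.repr F).support
  let P : E →ₗ[ℝ] E := ∑ k ∈ T, (b.coord k).smulRight (b k)
  have hP : ∀ F, P F = ∑ k ∈ T, b.coord k F • b k := fun F => by
    simp [P, LinearMap.sum_apply]
  have hPS : ∀ F ∈ S, P F = F := by
    intro F hF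
    conv_rhs => rw [← b.linearCombination_repr F, Finsupp.linearCombination_apply]
    rw [hP, Finsupp.sum_of_support_subset _
      (Finset.subset_biUnion_of_mem (fun F => (b.repr F).support) hF) _ (by simp)]
    rfl
  let q : X → _ × _ → E → ℝ := fun x p F =>
    -(|τ x (b p.1) (b p.2) / 2| * (b.coord p.1 F ^ 2 + b.coord p.2 F ^ 2) / 4)
  refine ⟨fun x F => if P F = F then (Real.exp (∑ p ∈ T ×ˢ T, q x p F) : ℂ) else 0,
    fun x => ⟨by simp [q], ?_⟩, fun F hF => ?_⟩
  · refine posSemidef_projKernel_cutoff (τ x) (hτ x) P ?_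
    convert posSemidef_projKernel_sum (T ×ˢ T) fun p =>
      posSemidef_projKernel_gaussian (τ x (b p.1) (b p.2) / 2) (b.coord p.1) (b.coord p.2) using 2
    funext F F'
    -- Antisymmetrisation of the expansion of the form in the basis.
    have h1 : ∀ F F', τ x (P F) (P F') =
        ∑ p ∈ T ×ˢ T, τ x (b p.1) (b p.2) * (b.coord p.1 F * b.coord p.2 F') := by
      intro F F'
      rw [Finset.sum_product, hP, hP, map_sum (τ x), LinearMap.sum_apply]
      refine Finset.sum_congr rfl fun k _ => ?_
      rw [map_sum]
      refine Finset.sum_congr rfl fun j _ => ?_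
      simp only [map_smul, LinearMap.smul_apply, smul_eq_mul]
      ring
    have h2 : τ x (P F) (P F') = (τ x (P F) (P F') - τ x (P F') (P F)) / 2 := by
      rw [hτ x (P F) (P F')]
      ring
    rw [h2, h1, h1, ← Finset.sum_sub_distrib, Finset.sum_div, Finset.sum_apply, Finset.sum_apply]
    refine Finset.sum_congr rfl fun p _ => ?_
    ring
  · simp only [if_pos (hPS F hF)]
    have h1 : Tendsto (fun x => ∑ p ∈ T ×ˢ T, q x p F) l (𝓝 (∑ p ∈ T ×ˢ T,
        -(|(0 : ℝ) / 2| * (b.coord p.1 F ^ 2 + b.coord p.2 F ^ 2) / 4))) :=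
      tendsto_finsetSum _ fun p _ =>
        (((((hl _ _).div_const 2).abs).mul_const _).div_const 4).neg
    have h2 := (Complex.continuous_ofReal.tendsto _).comp ((Real.continuous_exp.tendsto _).comp h1)
    simp only [zero_div, abs_zero, zero_mul, neg_zero, Finset.sum_const_zero, Real.exp_zero,
      Complex.ofReal_one] at h2
    exact h2

/-! ### Continuity of the norms in the form -/

namespace WeylSpan

variable {X : Type*} {l : Filter X} {G : X → PresymplecticForm E} {σ : PresymplecticForm E}
  {C : X → E → ℂ} {C₀ : E → ℂ}

theorem tendsto_projKernel (hG : ∀ F F', Tendsto (fun x => G x F F') l (𝓝 (σ F F')))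
    {F F' : E} (hC : Tendsto (fun x => C x (F' - F)) l (𝓝 (C₀ (F' - F)))) :
    Tendsto (fun x => projKernel (fun F F' => G x F F') (C x) F F') l
      (𝓝 (projKernel (fun F F' => σ F F') C₀ F F')) := by
  have h := (Complex.continuous_ofReal.tendsto _).comp (hG F F')
  exact ((Complex.continuous_exp.tendsto _).comp ((h.const_mul Complex.I).div_const 2)).mul hC

theorem tendsto_stateNorm (hG : ∀ F F', Tendsto (fun x => G x F F') l (𝓝 (σ F F'))) (a : E →₀ ℂ)
    (hC : ∀ F ∈ a.support, ∀ F' ∈ a.support,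
      Tendsto (fun x => C x (F' - F)) l (𝓝 (C₀ (F' - F)))) :
    Tendsto (fun x => stateNorm (G x) (C x) ((basis (G x)).repr.symm a)) l
      (𝓝 (stateNorm σ C₀ ((basis σ).repr.symm a))) := by
  simp only [stateNorm, omega_star_mul_self]
  refine (Real.continuous_sqrt.tendsto _).comp ((Complex.continuous_re.tendsto _).comp ?_)
  exact tendsto_finsetSum _ fun F hF => tendsto_finsetSum _ fun F' hF' =>
    ((tendsto_projKernel hG (hC F hF F' hF')).const_mul _).mul_const _

theorem IsState.of_tendsto [l.NeBot] (hG : ∀ F F', Tendsto (fun x => G x F F') l (𝓝 (σ F F')))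
    (h : ∀ x, IsState (G x) (C x)) (hC : ∀ F, Tendsto (fun x => C x F) l (𝓝 (C₀ F))) :
    IsState σ C₀ := by
  refine isState_iff_posSemidef.2 ⟨tendsto_nhds_unique (hC 0) ?_, ?_⟩
  · simp only [(h _).map_zero]
    exact tendsto_const_nhds
  · exact Matrix.PosSemidef.of_tendsto (fun x => (isState_iff_posSemidef.1 (h x)).2)
      fun F F' => tendsto_projKernel hG (hC _)

theorem exists_isState_lt_stateNorm {A : WeylSpan σ} {r : ℝ} (h : r < ‖A‖) :
    ∃ C, IsState σ C ∧ r < stateNorm σ C A := by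
  by_contra! H
  exact h.not_ge (norm_le H)

/-- Lower semicontinuity: a state for `σ` is turned into states for nearby forms by multiplication
with Gaussian states for the difference of the forms. -/
theorem eventually_lt_norm (hG : ∀ F F', Tendsto (fun x => G x F F') l (𝓝 (σ F F'))) (a : E →₀ ℂ)
    {r : ℝ} (hr : r < ‖(basis σ).repr.symm a‖) :
    ∀ᶠ x in l, r < ‖(basis (G x)).repr.symm a‖ := by
  classical
  obtain ⟨C, hC, hCr⟩ := exists_isState_lt_stateNorm hr
  obtain ⟨D, hD, hD1⟩ := exists_projKernel_tendsto_one (l := l)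
    (fun x => (G x).form - σ.form)
    (fun x F F' => by
      simp only [LinearMap.sub_apply, (G x).antisymm F F', σ.antisymm F F']
      ring)
    (fun F F' => by simpa using (hG F F').sub_const (σ F F'))
    (Finset.image₂ (fun F F' => F' - F) a.support a.support)
  have hCD : ∀ x, IsState (G x) (C * D x) := by
    refine fun x => isState_iff_posSemidef.2 ⟨by simp [hC.map_zero, (hD x).1], ?_⟩
    convert (isState_iff_posSemidef.1 hC).2.projKernel_add (hD x).2 using 2
    funext F F'
    simp
  have ht := tendsto_stateNorm (C := fun x => C * D x) hG a fun F hF F' hF' => by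
    simpa using (hD1 (F' - F) (Finset.mem_image₂_of_mem hF hF')).const_mul (C (F' - F))
  filter_upwards [ht.eventually_const_lt hCr] with x hx
  exact hx.trans_le ((hCD x).le_norm _)

/-- Upper semicontinuity: a pointwise limit along an ultrafilter of almost optimal states is a
state. -/
theorem eventually_norm_lt (hG : ∀ F F', Tendsto (fun x => G x F F') l (𝓝 (σ F F'))) (a : E →₀ ℂ)
    {r : ℝ} (hr : ‖(basis σ).repr.symm a‖ < r) :
    ∀ᶠ x in l, ‖(basis (G x)).repr.symm a‖ < r := by
  by_contra H
  simp only [not_eventually, not_lt] at H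
  have : (l ⊓ 𝓟 {x | r ≤ ‖(basis (G x)).repr.symm a‖}).NeBot := frequently_mem_iff_neBot.1 H
  obtain ⟨u, hu⟩ := Ultrafilter.exists_le (l ⊓ 𝓟 {x | r ≤ ‖(basis (G x)).repr.symm a‖})
  obtain ⟨hul, hu⟩ := le_inf_iff.1 hu
  rw [le_principal_iff] at hu
  obtain ⟨s, hs, hsr⟩ := exists_between hr
  have h1 : ∀ x, ∃ C, IsState (G x) C ∧ (r ≤ ‖(basis (G x)).repr.symm a‖ →
      s < stateNorm (G x) C ((basis (G x)).repr.symm a)) := by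
    intro x
    by_cases h : r ≤ ‖(basis (G x)).repr.symm a‖
    · obtain ⟨C, hC, hCr⟩ := exists_isState_lt_stateNorm (hsr.trans_le h)
      exact ⟨C, hC, fun _ => hCr⟩
    · exact ⟨delta E, isState_delta, fun h' => (h h').elim⟩
  choose C hC hCs using h1
  have h2 : ∀ F, ∃ c, Tendsto (fun x => C x F) u (𝓝 c) := by
    intro F
    obtain ⟨c, -, hc⟩ := (isCompact_closedBall (0 : ℂ) 1).ultrafilter_le_nhds
      (u.map fun x => C x F) <| le_principal_iff.2 <| mem_map.2 <|
        Eventually.of_forall fun x => mem_closedBall_zero_iff.2 ((hC x).norm_le_one F)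
    exact ⟨c, hc⟩
  choose C₀ hC₀ using h2
  have hG' : ∀ F F', Tendsto (fun x => G x F F') u (𝓝 (σ F F')) :=
    fun F F' => (hG F F').mono_left hul
  have h3 : s ≤ stateNorm σ C₀ ((basis σ).repr.symm a) :=
    ge_of_tendsto (tendsto_stateNorm hG' a fun F _ F' _ => hC₀ _) <| by
      filter_upwards [hu] with x hx using (hCs x hx).le
  exact hs.not_ge (h3.trans ((IsState.of_tendsto hG' hC hC₀).le_norm _))

/-- The norm of a fixed linear combination of Weyl elements depends continuously on the form. -/
theorem tendsto_norm (hG : ∀ F F', Tendsto (fun x => G x F F') l (𝓝 (σ F F'))) (a : E →₀ ℂ) :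
    Tendsto (fun x => ‖(basis (G x)).repr.symm a‖) l (𝓝 ‖(basis σ).repr.symm a‖) :=
  tendsto_order.2 ⟨fun _ h => eventually_lt_norm hG a h, fun _ h => eventually_norm_lt hG a h⟩

end WeylSpan

end Norm

/-! ### The continuous field of Weyl algebras -/

section Field

open Filter Topology

variable {E : Type*} [AddCommGroup E] [Module ℝ E] {X : Type*} (G : X → PresymplecticForm E)

/-- The sections `x ↦ ∑ₖ aₖ Wₓ(Fₖ)` with constant coefficients. -/
noncomputable def weylSection : (E →₀ ℂ) →ₗ[ℂ] ∀ x, WeylAlgebra (G x) :=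
  LinearMap.pi fun x =>
    (WeylAlgebra.of (G x)).toLinearMap ∘ₗ (WeylSpan.basis (G x)).repr.symm.toLinearMap

theorem weylSection_apply (a : E →₀ ℂ) (x : X) :
    weylSection G a x = WeylAlgebra.of (G x) ((WeylSpan.basis (G x)).repr.symm a) := rfl

theorem weylSection_single (F : E) (c : ℂ) :
    weylSection G (Finsupp.single F c) = fun x => c • WeylAlgebra.W (G x) F := by
  funext x
  rw [weylSection_apply, Module.Basis.repr_symm_single, map_smul]
  rfl

theorem dense_weylSection (x : X) :
    Dense {A : WeylAlgebra (G x) | ∃ h ∈ LinearMap.range (weylSection G), h x = A} := by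
  refine WeylAlgebra.denseRange_of.mono ?_
  rintro _ ⟨A, rfl⟩
  obtain ⟨a, rfl⟩ := (WeylSpan.basis (G x)).repr.symm.surjective A
  exact ⟨_, ⟨a, rfl⟩, rfl⟩

theorem star_weylSection_mem (a : E →₀ ℂ) :
    star (weylSection G a) ∈ LinearMap.range (weylSection G) := by
  induction a using Finsupp.induction_linear with
  | zero => simp
  | add a a' h h' =>
    rw [map_add, star_add]
    exact add_mem h h'
  | single F c =>
    refine ⟨Finsupp.single (-F) (star c), ?_⟩
    funext x
    rw [Pi.star_apply, weylSection_single, weylSection_single, star_smul, WeylAlgebra.star_W]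

variable {G} [TopologicalSpace X]

theorem continuous_norm_weylSection (hG : ∀ F F' : E, Continuous fun x => G x F F')
    (a : E →₀ ℂ) : Continuous fun x => ‖weylSection G a x‖ := by
  simp only [weylSection_apply, WeylAlgebra.norm_of]
  exact continuous_iff_continuousAt.2 fun x =>
    WeylSpan.tendsto_norm (fun F F' => (hG F F').continuousAt) a

/-- The phase factors in the products of Weyl elements are locally almost constant. -/
theorem weylSection_mul_mem (hG : ∀ F F' : E, Continuous fun x => G x F F') (a b : E →₀ ℂ) :
    weylSection G a * weylSection G b ∈ localClosure (LinearMap.range (weylSection G)) := by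
  induction a using Finsupp.induction_linear with
  | zero => simp
  | add a a' h h' =>
    rw [map_add, add_mul]
    exact add_mem h h'
  | single F c =>
    induction b using Finsupp.induction_linear with
    | zero => simp
    | add b b' h h' =>
      rw [map_add, mul_add]
      exact add_mem h h'
    | single F' c' =>
      let p : X → ℂ := fun x => c * c' * Complex.exp (-(Complex.I * (G x F F' : ℂ) / 2))
      have hp : Continuous p := by
        have h := Complex.continuous_ofReal.comp (hG F F')
        exact continuous_const.mul
          (Complex.continuous_exp.comp ((continuous_const.mul h).div_const 2).neg)
      have e : ∀ x, (weylSection G (Finsupp.single F c) * weylSection G (Finsupp.single F' c')) x =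
          p x • WeylAlgebra.W (G x) (F + F') := by
        intro x
        rw [Pi.mul_apply, weylSection_single, weylSection_single, smul_mul_smul_comm,
          WeylAlgebra.W_mul_W, smul_smul]
      refine mem_localClosure.2 fun x₀ ε hε => ⟨_, ⟨Finsupp.single (F + F') (p x₀), rfl⟩, ?_⟩
      have hc : Tendsto (fun x => ‖p x - p x₀‖ * ‖WeylAlgebra.W (G x) (F + F')‖) (𝓝 x₀)
          (𝓝 (‖p x₀ - p x₀‖ * ‖WeylAlgebra.W (G x₀) (F + F')‖)) := by
        have h1 := continuous_norm_weylSection hG (Finsupp.single (F + F') 1)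
        simp only [weylSection_single, one_smul] at h1
        exact ((hp.sub continuous_const).norm.mul h1).tendsto x₀
      rw [sub_self, norm_zero, zero_mul] at hc
      filter_upwards [hc.eventually_lt_const hε] with x hx
      rwa [e, weylSection_single, ← sub_smul, norm_smul]

end Field

theorem mainTheorem10 {E : Type*} [AddCommGroup E] [Module ℝ E]
    (G : Set.Ioi (0 : ℝ) → PresymplecticForm E)
    (hG : ∀ F F' : E, Continuous fun m => G m F F') :
    ∃! K : NonUnitalStarSubalgebra ℂ (∀ m : Set.Ioi (0 : ℝ), WeylAlgebra (G m)),
      IsContinuousField (fun m => WeylAlgebra (G m)) K ∧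
        ∀ F : E, (fun m => WeylAlgebra.W (G m) F) ∈ K := by
  have hW : ∀ K : NonUnitalStarSubalgebra ℂ (∀ m : Set.Ioi (0 : ℝ), WeylAlgebra (G m)),
      (∀ h ∈ LinearMap.range (weylSection G), h ∈ K) ↔
        ∀ F : E, (fun m => WeylAlgebra.W (G m) F) ∈ K := by
    refine fun K => ⟨fun h F => ?_, ?_⟩
    · simpa only [weylSection_single, one_smul] using h _ ⟨Finsupp.single F 1, rfl⟩
    · rintro h _ ⟨a, rfl⟩
      induction a using Finsupp.induction_linear with
      | zero => rw [map_zero]; exact zero_mem K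
      | add a a' h h' => rw [map_add]; exact add_mem h h'
      | single F c => rw [weylSection_single]; exact K.smul_mem c (h F)
  simp only [← hW]
  refine existsUnique_isContinuousField (A := fun m => WeylAlgebra (G m)) ?_
    (dense_weylSection G) ?_ ?_
  · rintro _ ⟨a, rfl⟩
    exact continuous_norm_weylSection hG a
  · rintro _ ⟨a, rfl⟩ _ ⟨b, rfl⟩
    exact weylSection_mul_mem hG a b
  · rintro _ ⟨a, rfl⟩
    exact le_localClosure (star_weylSection_mem G a)
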